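/- Let $q=2^s$ with $s\ge 1$, let $m$ be odd, let $\mu$ be a proper divisor of $q^m-1$ (so $1\le\mu<q^m-1$; $\mu=1$ is allowed), and let $n=\frac{q^m-1}{\mu}>4$. Put $$\delta=\left\lfloor\frac{q^{(m+1)/2}-q+1}{\mu}\right\rfloor$$ and suppose $\delta\ge 2$. Let $\beta\in\mathbf F_{q^m}$ be a primitive $n$-th root of unity, and for $i\ge 1$ let $\mathsf M_{\beta^i}(x)$ be the minimal polynomial of $\beta^i$ over $\mathbf F_q$. Let $$g(x)=\mathrm{lcm}\{\mathsf M_{\beta}(x),\mathsf M_{\beta^2}(x),\dots,\mathsf M_{\beta^{\delta-1}}(x)\}$$ (monic), and let $\mathbf C\subseteq\mathbf F_q^n$ be the narrow-sense BCH code, that is, the cyclic code of length $n$ over $\mathbf F_q$ with generator polynomial $g(x)$. Let $h^\perp(x)$ be the (monic) reciprocal polynomial of $(x^n+1)/g(x)$, where the reciprocal of $f$ is $f(0)^{-1}x^{\deg f}f(1/x)$. Here the generator polynomial of a cyclic code of length $N$ is the monic divisor of $x^N-1$ that generates it, a word $(c_0,\dots,c_{N-1})$ being identified with $c_0+c_1x+\cdots+c_{N-1}x^{N-1}\in\mathbf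 F_q[x]/(x^N-1)$. Let $d(\cdot)$ denote the minimum Hamming distance and ${}^\perp$ the Euclidean dual. Then $h^\perp(x)$ is the generator polynomial of $\mathbf C^\perp$, the product $g(x)h^\perp(x)$ is a monic divisor of $x^{2n}-1$, and the cyclic code $\mathbf C'$ of length $2n$ over $\mathbf F_q$ with generator polynomial $g(x)h^\perp(x)$ is Euclidean self-dual ($\mathbf C'=\mathbf C'^\perp$), has dimension $n$, and has minimum distance $$d(\mathbf C')=\min\{2d(\mathbf C),\,d(\mathbf C^\perp)\}\ge\delta .$$ If moreover $\mu=1$ and $q=2$, then $\mathbf C'$ is a binary self-dual cyclic code of length $2(2^m-1)$ and dimension $2^m-1$ with $d(\mathbf C')\ge 2^{(m+1)/2}$. -/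

import Mathlib

open Polynomial

noncomputable section

/-- The Euclidean dual of a linear code of length `N` over `F`. -/
def euclideanDual {F : Type*} [Field F] {N : ℕ} (C : Submodule F (Fin N → F)) :
    Submodule F (Fin N → F) where
  carrier := {c | ∀ y ∈ C, c ⬝ᵥ y = 0}
  zero_mem' := fun y _ => zero_dotProduct y
  add_mem' := fun {a b} ha hb y hy => by rw [add_dotProduct, ha y hy, hb y hy, add_zero]
  smul_mem' := fun r a ha y hy => by rw [smul_dotProduct, ha y hy, smul_zero]

/-- A code is Euclidean self-dual if it equals its Euclidean dual. -/
def IsSelfDualCode {F : Type*} [Field F] {N : ℕ} (C : Submodule F (Fin N → F)) : Prop :=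
  C = euclideanDual C

open Classical in
/-- The minimum Hamming distance between two distinct codewords
(with value `0` when there are no two distinct codewords). -/
def minDist {F : Type*} [Field F] {N : ℕ} (C : Submodule F (Fin N → F)) : ℕ :=
  sInf {d | ∃ a ∈ C, ∃ b ∈ C, a ≠ b ∧ hammingDist a b = d}

/-- A linear code is cyclic if `(c₀, …, c_{N-1}) ∈ C` implies `(c_{N-1}, c₀, …, c_{N-2}) ∈ C`.
Here `finRotate N` is `i ↦ i + 1` modulo `N`. -/
def IsCyclicCode {F : Type*} [Field F] {N : ℕ} (C : Submodule F (Fin N → F)) : Prop :=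
  ∀ c ∈ C, (fun i => c ((finRotate N).symm i)) ∈ C

/-- The polynomial `c₀ + c₁ x + ⋯ + c_{N-1} x^{N-1}` of a word `c`. -/
def wordPoly (F : Type*) [Field F] (N : ℕ) : (Fin N → F) →ₗ[F] F[X] where
  toFun c := ∑ i : Fin N, monomial (i : ℕ) (c i)
  map_add' a b := by simp [Finset.sum_add_distrib]
  map_smul' r a := by simp [Finset.smul_sum, smul_monomial]

/-- The code of length `N` generated by `f`: the words whose polynomial lies, modulo `x^N - 1`,
in the ideal of `F[x] / (x^N - 1)` generated by `f`. -/
def cyclicCode {F : Type*} [Field F] (N : ℕ) (f : F[X]) : Submodule F (Fin N → F) where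
  carrier := {c | Ideal.Quotient.mk (Ideal.span {(X ^ N - 1 : F[X])}) (wordPoly F N c) ∈
    Ideal.span {Ideal.Quotient.mk (Ideal.span {(X ^ N - 1 : F[X])}) f}}
  zero_mem' := by simp
  add_mem' := fun {a b} ha hb => by
    simp only [Set.mem_ofPred_eq, map_add] at *
    exact Ideal.add_mem _ ha hb
  smul_mem' := fun r a ha => by
    simp only [Set.mem_ofPred_eq, map_smul, smul_eq_C_mul, map_mul] at *
    exact Ideal.mul_mem_left _ _ ha

/-- `f` is the generator polynomial of the code `C` of length `N`: the monic divisor of `x^N - 1`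
that generates `C`. -/
def IsGeneratorPolynomial {F : Type*} [Field F] {N : ℕ} (C : Submodule F (Fin N → F))
    (f : F[X]) : Prop :=
  f.Monic ∧ f ∣ X ^ N - 1 ∧ C = cyclicCode N f

/-- The reciprocal polynomial `f(0)⁻¹ x^{deg f} f(1/x)`, scaled to be monic (for `f(0) ≠ 0`). -/
def reciprocalPoly {F : Type*} [Field F] (f : F[X]) : F[X] :=
  C (f.coeff 0)⁻¹ * f.reverse

open Classical in
/-- The (monic) least common multiple of the minimal polynomials over `F` of
`β^b, β^(b+1), …, β^(b+δ-2)`, for `δ ≥ 2`. -/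
def bchGenerator (F : Type*) {K : Type*} [Field F] [Field K] [Algebra F K]
    (δ b : ℕ) (β : K) : F[X] :=
  letI : NormalizedGCDMonoid F[X] := UniqueFactorizationMonoid.toNormalizedGCDMonoid F[X]
  (Finset.Icc b (b + δ - 2)).lcm (fun i => minpoly F (β ^ i))

/-- The BCH code of length `n` over `F` with designed distance `δ` and offset `b`, with respect to
the primitive `n`-th root of unity `β`. -/
def bchCode (F : Type*) {K : Type*} [Field F] [Field K] [Algebra F K]
    (n δ b : ℕ) (β : K) : Submodule F (Fin n → F) :=
  cyclicCode n (bchGenerator F δ b β)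

/-- The reciprocal polynomial of `(x^n + 1) / g`, where `g` is the generator polynomial of the
BCH code of length `n`, designed distance `δ` and offset `b` with respect to `β`. -/
def bchDualGenerator (F : Type*) {K : Type*} [Field F] [Field K] [Algebra F K]
    (n δ b : ℕ) (β : K) : F[X] :=
  reciprocalPoly ((X ^ n + 1) / bchGenerator F δ b β)

/-- The cyclic code of length `2 n` generated by `g · h^⊥`, where `g` is the generator polynomial
of the BCH code and `h^⊥` is the reciprocal polynomial of `(x^n + 1) / g`. -/
def doubledBCHCode (F : Type*) {K : Type*} [Field F] [Field K] [Algebra F K]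
    (n δ b : ℕ) (β : K) : Submodule F (Fin (2 * n) → F) :=
  cyclicCode (2 * n) (bchGenerator F δ b β * bchDualGenerator F n δ b β)

end

/-! ### Words and polynomials -/

section Words

variable {F : Type*} [Field F] {N : ℕ}

/-! Let `r` be the reciprocal of the check polynomial `(X ^ n - 1) / g`; it generates the dual of
the BCH code. Everything rests on `g ∣ r`, i.e. the code contains its dual. If this failed, some
root `β ^ j` of `g` would have its inverse conjugate to some `β ^ i`, with `1 ≤ i, j < δ`. Then `q ^
m - 1` would divide `iμ * q ^ k + jμ`, which `mul_pow_add_ne` excludes by size.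

Since `X ^ (2n) - 1 = (X ^ n - 1) ^ 2` in characteristic two, self-duality of the code generated by
`g * r` is formal and holds for any factorization of `X ^ n - 1`. For the distance
(`minDist_cyclicCode_two_mul`), cut a word into halves `u`, `w`. Either `u = w` lies in the code of
`g`, or `u + w` is a nonzero word of the code of `r`; both bounds are attained. The BCH bound and
dual containment then give `δ`, and evenness of binary self-dual weights gives the last unit. -/

theorem wordPoly_apply (c : Fin N → F) : wordPoly F N c = ∑ i : Fin N, monomial (i : ℕ) (c i) := rfl

theorem coeff_wordPoly (c : Fin N → F) (i : Fin N) : (wordPoly F N c).coeff i = c i := by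
  rw [wordPoly_apply, finsetSum_coeff, Finset.sum_eq_single i]
  · simp
  · intro j _ hj
    rw [coeff_monomial, if_neg (fun h => hj (Fin.ext h))]
  · simp

theorem degree_wordPoly_lt (c : Fin N → F) : (wordPoly F N c).degree < N := by
  rw [wordPoly_apply]
  exact mem_degreeLT.1 ((degreeLT F N).sum_mem fun i _ => monomial_coe_mem_degreeLT i (c i))

theorem wordPoly_injective : Function.Injective (wordPoly F N) := fun a b h => by
  ext i
  rw [← coeff_wordPoly a i, h, coeff_wordPoly]

theorem wordPoly_eq_zero_iff {c : Fin N → F} : wordPoly F N c = 0 ↔ c = 0 :=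
  map_eq_zero_iff _ wordPoly_injective

theorem wordPoly_coeff {p : F[X]} (hp : p.degree < N) :
    wordPoly F N (fun i => p.coeff i) = p := by
  simpa [wordPoly_apply] using p.sum_fin (monomial ·) (by simp) hp

/-- As `f` divides the modulus, divisibility by `f` is unaffected by reduction. -/
theorem mem_cyclicCode_iff {f : F[X]} (hf : f ∣ X ^ N - 1) {c : Fin N → F} :
    c ∈ cyclicCode N f ↔ f ∣ wordPoly F N c := by
  change Ideal.Quotient.mk _ _ ∈ Ideal.span _ ↔ _
  rw [Ideal.mem_span_singleton]
  constructor
  · rintro ⟨a, ha⟩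
    obtain ⟨a, rfl⟩ := Ideal.Quotient.mk_surjective a
    rw [← map_mul, Ideal.Quotient.mk_eq_mk_iff_sub_mem, Ideal.mem_span_singleton] at ha
    exact (dvd_sub_left (dvd_mul_right f a)).1 (hf.trans ha)
  · intro h
    exact map_dvd _ h

/-- A shift is multiplication by `X` modulo `X ^ N - 1`; only the wrapped coordinate leaves a
difference. -/
theorem isCyclicCode_cyclicCode (f : F[X]) : IsCyclicCode (cyclicCode N f) := by
  intro c hc
  change Ideal.Quotient.mk _ _ ∈ Ideal.span _
  have key : Ideal.Quotient.mk (Ideal.span {(X ^ N - 1 : F[X])})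
      (wordPoly F N fun i => c ((finRotate N).symm i)) =
      Ideal.Quotient.mk _ (X * wordPoly F N c) := by
    rw [Ideal.Quotient.mk_eq_mk_iff_sub_mem, wordPoly_apply, wordPoly_apply,
      ← Equiv.sum_comp (finRotate N), Finset.mul_sum, ← Finset.sum_sub_distrib]
    refine Ideal.sum_mem _ fun i _ => ?_
    rw [Equiv.symm_apply_apply, X_mul_monomial, Ideal.mem_span_singleton]
    obtain _ | k := N
    · exact i.elim0
    · rcases eq_or_ne i (Fin.last k) with rfl | hi
      · rw [finRotate_last, Fin.val_zero, Fin.val_last]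
        refine ⟨-C (c (Fin.last k)), ?_⟩
        rw [← C_mul_X_pow_eq_monomial, ← C_mul_X_pow_eq_monomial]
        ring
      · rw [coe_finRotate_of_ne_last hi, sub_self]
        exact dvd_zero _
  rw [key, map_mul]
  exact Ideal.mul_mem_left _ _ hc

theorem X_pow_sub_one_monic (hN : N ≠ 0) : (X ^ N - 1 : F[X]).Monic := monic_X_pow_sub_C 1 hN

theorem natDegree_add_natDegree_of_mul_eq {f h : F[X]} (hN : N ≠ 0) (hfh : f * h = X ^ N - 1) :
    f.natDegree + h.natDegree = N := by
  have h0 : f * h ≠ 0 := hfh ▸ (X_pow_sub_one_monic hN).ne_zero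
  rw [← natDegree_mul (left_ne_zero_of_mul h0) (right_ne_zero_of_mul h0), hfh]
  exact natDegree_X_pow_sub_C

/-- Multiplication by `f` maps the polynomials of degree below `deg h` bijectively onto the code. -/
theorem finrank_cyclicCode {f h : F[X]} (hN : N ≠ 0) (hfh : f * h = X ^ N - 1) :
    Module.finrank F (cyclicCode N f) = h.natDegree := by
  have hdeg := natDegree_add_natDegree_of_mul_eq hN hfh
  have h0 : f * h ≠ 0 := hfh ▸ (X_pow_sub_one_monic hN).ne_zero
  have hf0 := left_ne_zero_of_mul h0
  have hlt : ∀ p ∈ degreeLT F h.natDegree, (f * p).degree < N := fun p hp => by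
    rw [mem_degreeLT] at hp
    rw [degree_mul, degree_eq_natDegree hf0, ← hdeg, Nat.cast_add]
    exact WithBot.add_lt_add_left (WithBot.natCast_ne_bot _) hp
  let φ : degreeLT F h.natDegree →ₗ[F] (Fin N → F) :=
    { toFun := fun p i => (f * p.1).coeff i
      map_add' := fun p r => by ext; simp [mul_add]
      map_smul' := fun a p => by ext; simp }
  have hφ : ∀ p, wordPoly F N (φ p) = f * p.1 := fun p => wordPoly_coeff (hlt p.1 p.2)
  have hinj : Function.Injective φ := fun p r hpr => by
    have := congrArg (wordPoly F N) hpr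
    rw [hφ, hφ] at this
    exact Subtype.ext (mul_left_cancel₀ hf0 this)
  have hrange : LinearMap.range φ = cyclicCode N f := by
    ext c
    rw [mem_cyclicCode_iff ⟨h, hfh.symm⟩, LinearMap.mem_range]
    constructor
    · rintro ⟨p, rfl⟩
      exact ⟨p, hφ p⟩
    · rintro ⟨p, hp⟩
      have hp' : p ∈ degreeLT F h.natDegree := by
        have := degree_wordPoly_lt c
        rw [hp, degree_mul, degree_eq_natDegree hf0, ← hdeg, Nat.cast_add] at this
        exact mem_degreeLT.2 (lt_of_add_lt_add_left this)
      exact ⟨⟨p, hp'⟩, wordPoly_injective ((hφ _).trans hp.symm)⟩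
  rw [← hrange, LinearMap.finrank_range_of_inj hinj, (degreeLTEquiv F _).finrank_eq,
    Module.finrank_fin_fun]

/-! ### Euclidean duals -/

theorem finrank_euclideanDual (C : Submodule F (Fin N → F)) :
    Module.finrank F (euclideanDual C) = N - Module.finrank F C := by
  have hsymm : (dotProductBilin F F : LinearMap.BilinForm F (Fin N → F)).IsSymm :=
    ⟨fun x y => dotProduct_comm x y⟩
  have hnd : (dotProductBilin F F : LinearMap.BilinForm F (Fin N → F)).Nondegenerate :=
    hsymm.isRefl.nondegenerate_iff_separatingLeft.2 fun x hx => dotProduct_eq_zero _ hx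
  have h := LinearMap.BilinForm.finrank_orthogonal hnd C
  rw [Module.finrank_fin_fun] at h
  rw [← h]
  refine congrArg (fun S : Submodule F (Fin N → F) => Module.finrank F S) ?_
  ext x
  constructor
  · intro hx y hy
    exact (dotProduct_comm _ _).trans (hx y hy)
  · intro hx y hy
    exact (dotProduct_comm _ _).trans (hx y hy)

/-! ### Reciprocal polynomials and duals of cyclic codes -/

theorem reverse_X_pow_sub_one : (X ^ N - 1 : F[X]).reverse = 1 - X ^ N := by
  have hd : (X ^ N - 1 : F[X]).natDegree = N := natDegree_X_pow_sub_C (r := 1)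
  rw [reverse, hd, reflect_sub, reflect_monomial, reflect_one, revAt_le le_rfl, Nat.sub_self,
    pow_zero]

theorem coeff_zero_X_pow_sub_one (hN : N ≠ 0) : (X ^ N - 1 : F[X]).coeff 0 = -1 := by
  simp [coeff_X_pow, hN.symm]

theorem reciprocalPoly_X_pow_sub_one (hN : N ≠ 0) :
    reciprocalPoly (X ^ N - 1 : F[X]) = X ^ N - 1 := by
  rw [reciprocalPoly, coeff_zero_X_pow_sub_one hN, reverse_X_pow_sub_one]
  simp [inv_neg]

theorem reciprocalPoly_mul (f g : F[X]) :
    reciprocalPoly (f * g) = reciprocalPoly f * reciprocalPoly g := by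
  rw [reciprocalPoly, reciprocalPoly, reciprocalPoly, mul_coeff_zero, mul_inv, C_mul,
    reverse_mul_of_domain]
  ring

theorem natDegree_reverse_of_coeff_zero_ne {f : F[X]} (hf : f.coeff 0 ≠ 0) :
    f.reverse.natDegree = f.natDegree := by
  rw [reverse_natDegree, natTrailingDegree_eq_zero_of_constantCoeff_ne_zero hf, Nat.sub_zero]

theorem reverse_reverse_of_coeff_zero_ne {f : F[X]} (hf : f.coeff 0 ≠ 0) :
    f.reverse.reverse = f := by
  rw [reverse, natDegree_reverse_of_coeff_zero_ne hf, reverse, reflect_reflect]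

theorem reciprocalPoly_monic {f : F[X]} (hf : f.coeff 0 ≠ 0) : (reciprocalPoly f).Monic := by
  rw [reciprocalPoly, Monic, leadingCoeff_mul, leadingCoeff_C, reverse_leadingCoeff, trailingCoeff,
    natTrailingDegree_eq_zero_of_constantCoeff_ne_zero hf, inv_mul_cancel₀ hf]

theorem reciprocalPoly_reciprocalPoly {f : F[X]} (hf : f.coeff 0 ≠ 0) (hm : f.Monic) :
    reciprocalPoly (reciprocalPoly f) = f := by
  have h : (C (f.coeff 0)⁻¹ * f.reverse).reverse = C (f.coeff 0)⁻¹ * f := by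
    rw [reverse_mul_of_domain, reverse_C, reverse_reverse_of_coeff_zero_ne hf]
  rw [reciprocalPoly, reciprocalPoly, h, mul_coeff_zero, coeff_C_zero, coeff_zero_reverse,
    hm.leadingCoeff, mul_one, inv_inv, ← mul_assoc, ← C_mul, mul_inv_cancel₀ hf, C_1, one_mul]

theorem natDegree_reciprocalPoly {f : F[X]} (hf : f.coeff 0 ≠ 0) :
    (reciprocalPoly f).natDegree = f.natDegree := by
  rw [reciprocalPoly, natDegree_C_mul (inv_ne_zero hf), natDegree_reverse_of_coeff_zero_ne hf]

theorem coeff_zero_ne_of_dvd {f : F[X]} (hN : N ≠ 0) (hf : f ∣ X ^ N - 1) : f.coeff 0 ≠ 0 := by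
  obtain ⟨h, hh⟩ := hf
  have := congrArg (fun p => coeff p 0) hh
  simp only [coeff_zero_X_pow_sub_one hN, mul_coeff_zero] at this
  intro h0
  simp [h0] at this

theorem reciprocalPoly_mul_eq {f h : F[X]} (hN : N ≠ 0) (hfh : f * h = X ^ N - 1) :
    reciprocalPoly f * reciprocalPoly h = X ^ N - 1 := by
  rw [← reciprocalPoly_mul, hfh, reciprocalPoly_X_pow_sub_one hN]

/-- Reflecting one factor turns the pairing into a convolution, so orthogonality becomes the
vanishing of one coefficient. -/
theorem dotProduct_eq_coeff (c d : Fin N → F) :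
    c ⬝ᵥ d = (wordPoly F N c * reflect (N - 1) (wordPoly F N d)).coeff (N - 1) := by
  rw [coeff_mul, Finset.Nat.sum_antidiagonal_eq_sum_range_succ
    (fun i j => (wordPoly F N c).coeff i * (reflect (N - 1) (wordPoly F N d)).coeff j)]
  obtain _ | k := N
  · simp [wordPoly_apply]
  · rw [Nat.add_sub_cancel, ← Fin.sum_univ_eq_sum_range (fun i => (wordPoly F (k + 1) c).coeff i *
      (reflect k (wordPoly F (k + 1) d)).coeff (k - i))]
    refine Finset.sum_congr rfl fun i _ => ?_
    have hi : (i : ℕ) ≤ k := Nat.lt_succ_iff.1 i.2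
    rw [coeff_wordPoly, coeff_reflect, revAt_le (Nat.sub_le _ _), Nat.sub_sub_self hi,
      coeff_wordPoly]

/-- The dual of the cyclic code generated by `f` is generated by the reciprocal of the check
polynomial. -/
theorem euclideanDual_cyclicCode {f h : F[X]} (hN : N ≠ 0) (hfh : f * h = X ^ N - 1) :
    euclideanDual (cyclicCode N f) = cyclicCode N (reciprocalPoly h) := by
  have hdeg := natDegree_add_natDegree_of_mul_eq hN hfh
  have hh0 : h.coeff 0 ≠ 0 := coeff_zero_ne_of_dvd hN ⟨f, by rw [← hfh, mul_comm]⟩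
  have hrec : reciprocalPoly h * reciprocalPoly f = X ^ N - 1 :=
    reciprocalPoly_mul_eq hN ((mul_comm _ _).trans hfh)
  have hf0 : f ≠ 0 := left_ne_zero_of_mul (hfh ▸ (X_pow_sub_one_monic (F := F) hN).ne_zero)
  have hfc : f.coeff 0 ≠ 0 := coeff_zero_ne_of_dvd hN ⟨h, hfh.symm⟩
  symm
  refine Submodule.eq_of_le_of_finrank_eq ?_ ?_
  · intro c hc d hd
    rw [mem_cyclicCode_iff ⟨_, hrec.symm⟩] at hc
    rw [mem_cyclicCode_iff ⟨_, hfh.symm⟩] at hd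
    obtain ⟨a, ha⟩ := hc
    obtain ⟨b, hb⟩ := hd
    rcases eq_or_ne a 0 with rfl | ha0
    · rw [mul_zero, wordPoly_eq_zero_iff] at ha
      rw [ha, zero_dotProduct]
    rcases eq_or_ne b 0 with rfl | hb0
    · rw [mul_zero, wordPoly_eq_zero_iff] at hb
      rw [hb, dotProduct_zero]
    have hr0 : reciprocalPoly h ≠ 0 := (reciprocalPoly_monic hh0).ne_zero
    have hca : h.natDegree + a.natDegree < N := by
      rw [← natDegree_reciprocalPoly hh0, ← natDegree_mul hr0 ha0, ← ha]
      exact (natDegree_lt_iff_degree_lt (ha ▸ mul_ne_zero hr0 ha0)).2 (degree_wordPoly_lt c)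
    have hdb : f.natDegree + b.natDegree < N := by
      rw [← natDegree_mul hf0 hb0, ← hb]
      exact (natDegree_lt_iff_degree_lt (hb ▸ mul_ne_zero hf0 hb0)).2 (degree_wordPoly_lt d)
    -- Splitting `N - 1` as `deg f + k` lets the reflection act on `f` and `b` separately, producing
    -- the factor `X ^ N - 1`.
    obtain ⟨k, hk⟩ : ∃ k, N - 1 = f.natDegree + k := ⟨N - 1 - f.natDegree, by omega⟩
    have hbk : b.natDegree ≤ k := by omega
    have hfr : f.reverse = C (f.coeff 0) * reciprocalPoly f := by
      rw [reciprocalPoly, ← mul_assoc, ← C_mul, mul_inv_cancel₀ hfc, C_1, one_mul]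
    have hprod : wordPoly F N c * reflect (N - 1) (wordPoly F N d) =
        (X ^ N - 1) * (C (f.coeff 0) * (a * reflect k b)) := by
      rw [ha, hb, hk, reflect_mul f b le_rfl hbk, ← hrec, ← reverse, hfr]
      ring
    -- The cofactor has degree below `N - 1`, so neither it nor its multiple by `X ^ N` reaches the
    -- coefficient at `N - 1`.
    have hpd : (C (f.coeff 0) * (a * reflect k b)).natDegree < N - 1 := by
      refine (natDegree_C_mul_le _ _).trans_lt (natDegree_mul_le.trans_lt ?_)
      have := natDegree_reflect_le (N := k) (p := b)
      omega
    rw [dotProduct_eq_coeff, hprod, sub_mul, one_mul, coeff_sub, coeff_X_pow_mul',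
      if_neg (by omega), coeff_eq_zero_of_natDegree_lt hpd, sub_zero]
  · rw [finrank_euclideanDual, finrank_cyclicCode hN hrec, finrank_cyclicCode hN hfh,
      natDegree_reciprocalPoly hfc]
    omega

end Words

/-! ### Minimum distance -/

section MinDist

variable {F : Type*} [Field F] {N : ℕ} {C : Submodule F (Fin N → F)}

open Classical in
theorem minDist_le_hammingNorm {c : Fin N → F} (hc : c ∈ C) (h0 : c ≠ 0) :
    minDist C ≤ hammingNorm c :=
  Nat.sInf_le ⟨c, hc, 0, C.zero_mem, h0, hammingDist_zero_right c⟩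

open Classical in
-- The trivial code is excluded because its `minDist` takes the default value `0`.
theorem exists_hammingNorm_eq_minDist (hC : C ≠ ⊥) :
    ∃ c ∈ C, c ≠ 0 ∧ hammingNorm c = minDist C := by
  obtain ⟨c, hc, h0⟩ := C.ne_bot_iff.1 hC
  obtain ⟨a, ha, b, hb, hab, h⟩ := Nat.sInf_mem
    (s := {d | ∃ a ∈ C, ∃ b ∈ C, a ≠ b ∧ hammingDist a b = d})
    ⟨_, c, hc, 0, C.zero_mem, h0, rfl⟩
  refine ⟨-a + b, C.add_mem (C.neg_mem ha) hb, fun h => hab (neg_add_eq_zero.1 h), ?_⟩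
  rw [← hammingDist_eq_hammingNorm]
  exact h

open Classical in
theorem le_minDist (hC : C ≠ ⊥) {d : ℕ} (h : ∀ c ∈ C, c ≠ 0 → d ≤ hammingNorm c) :
    d ≤ minDist C := by
  obtain ⟨c, hc, h0, hd⟩ := exists_hammingNorm_eq_minDist hC
  exact hd ▸ h c hc h0

theorem minDist_anti {D : Submodule F (Fin N → F)} (hD : D ≠ ⊥) (h : D ≤ C) :
    minDist C ≤ minDist D :=
  le_minDist hD fun _ hc h0 => minDist_le_hammingNorm (h hc) h0

/-- Words of a binary self-dual code have even weight. -/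
theorem even_minDist_of_isSelfDualCode (hF : Nat.card F = 2) (hC : IsSelfDualCode C)
    (h0 : C ≠ ⊥) : Even (minDist C) := by
  classical
  have : Finite F := Nat.finite_of_card_ne_zero (by omega)
  have := Fintype.ofFinite F
  have hF' : Fintype.card F = 2 := by rw [← Nat.card_eq_fintype_card, hF]
  have : CharP F 2 := charP_of_card_eq_prime hF'
  obtain ⟨c, hc, -, hd⟩ := exists_hammingNorm_eq_minDist h0
  have hcc : c ⬝ᵥ c = 0 := by
    have h : c ∈ euclideanDual C := hC ▸ hc
    exact h c hc
  -- Over the field with two elements, `c ⬝ᵥ c` is the weight of `c` modulo two.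
  rw [← hd, even_iff_two_dvd, ← CharP.cast_eq_zero_iff F 2, ← hcc, hammingNorm,
    Finset.card_eq_sum_ones, Finset.sum_filter, Nat.cast_sum]
  refine Finset.sum_congr rfl fun i _ => ?_
  split_ifs with hi
  · have := FiniteField.pow_card_sub_one_eq_one (c i) hi
    rw [hF', pow_one] at this
    simp [this]
  · rw [not_not.1 hi]
    simp

end MinDist

/-! ### Repeated-root cyclic codes of length `2 * n` in characteristic two -/

section Doubling

variable {n : ℕ}

theorem Fin.sum_univ_two_mul {M : Type*} [AddCommMonoid M] (f : Fin (2 * n) → M) :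
    ∑ i, f i = ∑ i : Fin n, f ⟨i, by omega⟩ + ∑ i : Fin n, f ⟨n + i, by omega⟩ := by
  rw [← Equiv.sum_comp (finCongr (two_mul n).symm) f, Fin.sum_univ_add]
  rfl

variable {F : Type*} [Field F]

open Classical in
theorem hammingNorm_eq_sum {N : ℕ} (c : Fin N → F) :
    hammingNorm c = ∑ i, if c i ≠ 0 then 1 else 0 := by
  rw [hammingNorm, Finset.card_eq_sum_ones, Finset.sum_filter]

open Classical in
theorem hammingNorm_two_mul (c : Fin (2 * n) → F) :
    hammingNorm c = hammingNorm (fun i : Fin n => c ⟨i, by omega⟩) +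
      hammingNorm (fun i : Fin n => c ⟨n + i, by omega⟩) := by
  rw [hammingNorm_eq_sum, hammingNorm_eq_sum, hammingNorm_eq_sum, Fin.sum_univ_two_mul]

theorem wordPoly_two_mul (c : Fin (2 * n) → F) :
    wordPoly F (2 * n) c = wordPoly F n (fun i : Fin n => c ⟨i, by omega⟩) +
      X ^ n * wordPoly F n (fun i : Fin n => c ⟨n + i, by omega⟩) := by
  rw [wordPoly_apply, wordPoly_apply, wordPoly_apply, Fin.sum_univ_two_mul, Finset.mul_sum]
  simp only [X_pow_mul_monomial, add_comm n]

open Classical in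
theorem hammingNorm_add_le {N : ℕ} (u w : Fin N → F) :
    hammingNorm (u + w) ≤ hammingNorm u + hammingNorm w := by
  rw [hammingNorm_eq_sum, hammingNorm_eq_sum, hammingNorm_eq_sum, ← Finset.sum_add_distrib]
  refine Finset.sum_le_sum fun i _ => ?_
  by_cases hu : u i = 0 <;> by_cases hw : w i = 0 <;> simp [hu, hw]
  split_ifs <;> omega

variable [CharP F 2]

theorem X_pow_two_mul_sub_one : (X ^ (2 * n) - 1 : F[X]) = (X ^ n - 1) * (X ^ n - 1) := by
  have h2 : (2 : F[X]) = 0 := CharTwo.two_eq_zero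
  linear_combination (X ^ n - 1) * h2

theorem squarefree_X_pow_sub_one (hn : Odd n) : Squarefree (X ^ n - 1 : F[X]) := by
  refine (X_pow_sub_one_separable_iff.2 fun h => ?_).squarefree
  rw [CharP.cast_eq_zero_iff F 2] at h
  exact Nat.not_even_iff_odd.2 hn (even_iff_two_dvd.2 h)

/-- A polynomial in characteristic two over a perfect field all of whose odd coefficients vanish is
a square. -/
theorem exists_eq_sq_of_odd_coeff_eq_zero [PerfectRing F 2] {p : F[X]}
    (hp : ∀ i, Odd i → p.coeff i = 0) : ∃ e : F[X], p = e ^ 2 := by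
  have hd : derivative p = 0 := by
    ext i
    rw [coeff_derivative, coeff_zero]
    rcases Nat.even_or_odd (i + 1) with h | h
    · have h' : ((i + 1 : ℕ) : F) = 0 := (CharP.cast_eq_zero_iff F 2 _).2 h.two_dvd
      rw [← Nat.cast_add_one, h', mul_zero]
    · rw [hp _ h, zero_mul]
  -- Zero derivative makes `p` a polynomial in `X ^ 2`; perfectness supplies square roots of its
  -- coefficients.
  exact ⟨_, (expand_contract 2 hd two_ne_zero).symm.trans (polynomial_expand_eq F 2 _)⟩

/-- The minimum distance of a repeated-root cyclic code of length `2 * n`, which is equivalent to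
the `(u | u + v)` construction applied to the cyclic codes generated by `g` and `r`. -/
theorem minDist_cyclicCode_two_mul [PerfectRing F 2] {g r : F[X]} (hn : Odd n) (hgr : g ∣ r)
    (hr : r ∣ X ^ n - 1) (h0 : cyclicCode n r ≠ ⊥) :
    minDist (cyclicCode (2 * n) (g * r)) =
      min (2 * minDist (cyclicCode n g)) (minDist (cyclicCode n r)) := by
  classical
  have hg : g ∣ X ^ n - 1 := hgr.trans hr
  have hsq := squarefree_X_pow_sub_one (F := F) hn
  have hG : g * r ∣ X ^ (2 * n) - 1 := X_pow_two_mul_sub_one (F := F) (n := n) ▸ mul_dvd_mul hg hr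
  have hle : cyclicCode n r ≤ cyclicCode n g := fun c hc =>
    (mem_cyclicCode_iff hg).2 (hgr.trans ((mem_cyclicCode_iff hr).1 hc))
  have hg0 : cyclicCode n g ≠ ⊥ := fun h => h0 (le_bot_iff.1 (h ▸ hle))
  have upper₁ : ∃ c ∈ cyclicCode (2 * n) (g * r), c ≠ 0 ∧
      hammingNorm c = 2 * minDist (cyclicCode n g) := by
    obtain ⟨u, hu, hu0, hud⟩ := exists_hammingNorm_eq_minDist hg0
    -- The word `(u | u)` has polynomial `u * (X ^ n - 1)`.
    let c : Fin (2 * n) → F := fun i => if h : (i : ℕ) < n then u ⟨i, h⟩ else u ⟨i - n, by omega⟩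
    have h1 : (fun i : Fin n => c ⟨i, by omega⟩) = u := by ext i; simp [c]
    have h2 : (fun i : Fin n => c ⟨n + i, by omega⟩) = u := by ext i; simp [c]
    have hnorm : hammingNorm c = 2 * hammingNorm u := by
      rw [hammingNorm_two_mul, h1, h2, two_mul]
    refine ⟨c, ?_, ?_, by rw [hnorm, hud]⟩
    · rw [mem_cyclicCode_iff hG, wordPoly_two_mul, h1, h2]
      have : wordPoly F n u + X ^ n * wordPoly F n u = wordPoly F n u * (X ^ n - 1) := by
        have h2 : (2 : F[X]) = 0 := CharTwo.two_eq_zero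
        linear_combination wordPoly F n u * h2
      rw [this]
      exact mul_dvd_mul ((mem_cyclicCode_iff hg).1 hu) hr
    · rw [← hammingNorm_ne_zero_iff, hnorm]
      exact mul_ne_zero two_ne_zero (hammingNorm_ne_zero_iff.2 hu0)
  have upper₂ : ∃ c ∈ cyclicCode (2 * n) (g * r), c ≠ 0 ∧
      hammingNorm c = minDist (cyclicCode n r) := by
    obtain ⟨v, hv, hv0, hvd⟩ := exists_hammingNorm_eq_minDist h0
    -- As `n` is odd, exactly one of `i` and `n + i` is even; `v i` is placed there. This keeps the
    -- weight and the class modulo `X ^ n - 1`.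
    let c : Fin (2 * n) → F := fun i => if Even (i : ℕ) then
      (if h : (i : ℕ) < n then v ⟨i, h⟩ else v ⟨i - n, by omega⟩) else 0
    have h1 : (fun i : Fin n => c ⟨i, by omega⟩) = fun i : Fin n => if Even (i : ℕ) then v i else 0 := by
      ext i; simp [c]
    have h2 : (fun i : Fin n => c ⟨n + i, by omega⟩) =
        fun i : Fin n => if Even (i : ℕ) then 0 else v i := by
      ext i
      have : Even (n + i) ↔ ¬ Even (i : ℕ) := by
        rw [Nat.even_add]
        have := Nat.not_even_iff_odd.2 hn
        tauto
      simp only [c, this]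
      by_cases h : Even (i : ℕ) <;> simp [h]
    have hnorm : hammingNorm c = hammingNorm v := by
      rw [hammingNorm_two_mul, h1, h2, hammingNorm_eq_sum, hammingNorm_eq_sum, hammingNorm_eq_sum,
        ← Finset.sum_add_distrib]
      refine Finset.sum_congr rfl fun i _ => ?_
      by_cases h : Even (i : ℕ) <;> simp [h]
    refine ⟨c, ?_, ?_, by rw [hnorm, hvd]⟩
    · rw [mem_cyclicCode_iff hG]
      have hr' : r ∣ wordPoly F (2 * n) c := by
        have hsum : wordPoly F (2 * n) c = wordPoly F n v +
            (X ^ n - 1) * wordPoly F n (fun i : Fin n => c ⟨n + i, by omega⟩) := by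
          have hv' : v = (fun i : Fin n => c ⟨i, by omega⟩) +
              fun i : Fin n => c ⟨n + i, by omega⟩ := by
            rw [h1, h2]
            ext i
            by_cases h : Even (i : ℕ) <;> simp [h]
          rw [wordPoly_two_mul]
          conv_rhs => rw [hv', map_add]
          ring
        rw [hsum]
        exact dvd_add ((mem_cyclicCode_iff hr).1 hv) (hr.mul_right _)
      -- Even support makes the polynomial a square `e ^ 2`; since `r` is squarefree, `r ∣ e`, hence
      -- `g * r ∣ e ^ 2`.
      obtain ⟨e, he⟩ := exists_eq_sq_of_odd_coeff_eq_zero (p := wordPoly F (2 * n) c) (by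
        intro i hi
        by_cases hin : i < 2 * n
        · rw [coeff_wordPoly c ⟨i, hin⟩]
          exact if_neg (Nat.not_even_iff_odd.2 hi)
        · exact coeff_eq_zero_of_degree_lt ((degree_wordPoly_lt c).trans_le (by
            exact_mod_cast not_lt.1 hin)))
      rw [he] at hr' ⊢
      have hre := ((hsq.squarefree_of_dvd hr).dvd_pow_iff_dvd two_ne_zero).1 hr'
      rw [sq]
      exact mul_dvd_mul (hgr.trans hre) hre
    · rw [← hammingNorm_ne_zero_iff, hnorm]
      exact hammingNorm_ne_zero_iff.2 hv0
  obtain ⟨c₁, hc₁, hc₁0, hd₁⟩ := upper₁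
  obtain ⟨c₂, hc₂, hc₂0, hd₂⟩ := upper₂
  refine le_antisymm (le_min (hd₁ ▸ minDist_le_hammingNorm hc₁ hc₁0)
    (hd₂ ▸ minDist_le_hammingNorm hc₂ hc₂0))
    (le_minDist ((Submodule.ne_bot_iff _).2 ⟨c₁, hc₁, hc₁0⟩) fun c hc hc0 => ?_)
  rw [mem_cyclicCode_iff hG, wordPoly_two_mul] at hc
  rw [hammingNorm_two_mul]
  have hc0' : (fun i : Fin n => c ⟨i, by omega⟩) ≠ 0 ∨
      (fun i : Fin n => c ⟨n + i, by omega⟩) ≠ 0 := by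
    by_contra! h
    refine hc0 (hammingNorm_eq_zero.1 ?_)
    rw [hammingNorm_two_mul, h.1, h.2, hammingNorm_zero]
  generalize (fun i : Fin n => c ⟨i, by omega⟩) = u at hc hc0' ⊢
  generalize (fun i : Fin n => c ⟨n + i, by omega⟩) = w at hc hc0' ⊢
  by_cases huw : u + w = 0
  · obtain rfl : u = w := by
      rw [eq_neg_of_add_eq_zero_left huw]
      ext i
      simp [CharTwo.neg_eq]
    have hu0 : u ≠ 0 := by tauto
    have hug : g ∣ wordPoly F n u := by
      obtain ⟨t, ht⟩ := hr
      have hr0 : r ≠ 0 :=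
        left_ne_zero_of_mul (ht ▸ (X_pow_sub_one_monic (F := F) hn.pos.ne').ne_zero)
      have hfac : wordPoly F n u + X ^ n * wordPoly F n u = (t * wordPoly F n u) * r := by
        have h2 : (2 : F[X]) = 0 := CharTwo.two_eq_zero
        linear_combination wordPoly F n u * (h2 + ht)
      rw [hfac] at hc
      have hgt : g ∣ t * wordPoly F n u := (mul_dvd_mul_iff_right hr0).1 hc
      obtain ⟨k, rfl⟩ := hgr
      -- Here `t = (X ^ n - 1) / r` is coprime to `g`, because `g ∣ r` and `X ^ n - 1` is
      -- squarefree.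
      have hcop : IsRelPrime g t := by
        have : Squarefree (g * t * k) := by
          rw [mul_right_comm, ← ht]; exact hsq
        exact (squarefree_mul_iff.1 (this.squarefree_of_dvd (dvd_mul_right _ _))).1
      exact hcop.dvd_of_dvd_mul_left hgt
    have := minDist_le_hammingNorm ((mem_cyclicCode_iff hg).2 hug) hu0
    omega
  · have huv : r ∣ wordPoly F n (u + w) := by
      have h1 : wordPoly F n (u + w) = wordPoly F n u + X ^ n * wordPoly F n w -
          (X ^ n - 1) * wordPoly F n w := by
        rw [map_add]
        ring
      rw [h1]
      exact dvd_sub ((dvd_mul_left r g).trans hc) (hr.mul_right _)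
    have := minDist_le_hammingNorm ((mem_cyclicCode_iff hr).2 huv) huw
    have := hammingNorm_add_le u w
    omega

/-- If `g * h = X ^ n - 1`, then `g` times the reciprocal of `h` generates a self-dual code of
length `2 * n`. -/
theorem isSelfDualCode_cyclicCode_two_mul {g h : F[X]} (hn : n ≠ 0) (hg : g.Monic)
    (hgh : g * h = X ^ n - 1) : IsSelfDualCode (cyclicCode (2 * n) (g * reciprocalPoly h)) := by
  have hrec := reciprocalPoly_mul_eq hn hgh
  have hm : h.Monic := hg.of_mul_monic_left (hgh ▸ X_pow_sub_one_monic hn)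
  have hh0 : h.coeff 0 ≠ 0 := coeff_zero_ne_of_dvd hn ⟨g, by rw [← hgh, mul_comm]⟩
  have hg0 : g.coeff 0 ≠ 0 := coeff_zero_ne_of_dvd hn ⟨h, hgh.symm⟩
  -- The check polynomial is `reciprocalPoly g * h`, whose reciprocal is again `g * reciprocalPoly
  -- h`.
  rw [IsSelfDualCode, euclideanDual_cyclicCode (N := 2 * n) (f := g * reciprocalPoly h)
    (h := reciprocalPoly g * h) (mul_ne_zero two_ne_zero hn), reciprocalPoly_mul,
    reciprocalPoly_reciprocalPoly hg0 hg]
  rw [X_pow_two_mul_sub_one]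
  nth_rw 1 [← hgh]
  rw [← hrec]
  ring

theorem finrank_cyclicCode_two_mul {g h : F[X]} (hn : n ≠ 0)
    (hgh : g * h = X ^ n - 1) :
    Module.finrank F (cyclicCode (2 * n) (g * reciprocalPoly h)) = n := by
  have hrec := reciprocalPoly_mul_eq hn hgh
  have hh0 : h.coeff 0 ≠ 0 := coeff_zero_ne_of_dvd hn ⟨g, by rw [← hgh, mul_comm]⟩
  have hg0 : g.coeff 0 ≠ 0 := coeff_zero_ne_of_dvd hn ⟨h, hgh.symm⟩
  have hmul : g * reciprocalPoly h * (reciprocalPoly g * h) = X ^ (2 * n) - 1 := by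
    rw [X_pow_two_mul_sub_one]
    nth_rw 1 [← hgh]
    rw [← hrec]
    ring
  rw [finrank_cyclicCode (mul_ne_zero two_ne_zero hn) hmul,
    natDegree_mul (reciprocalPoly_monic hg0).ne_zero (fun h' => hh0 (by simp [h'])),
    natDegree_reciprocalPoly hg0, natDegree_add_natDegree_of_mul_eq hn hgh]

end Doubling

/-! ### BCH codes -/

section BCH

variable {F K : Type*} [Field F] [Field K] [Algebra F K] {n δ b : ℕ} {β : K}

theorem minpoly_dvd_bchGenerator {i : ℕ} (hb : b ≤ i) (hi : i ≤ b + δ - 2) :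
    minpoly F (β ^ i) ∣ bchGenerator F δ b β := by
  classical
  let : NormalizedGCDMonoid F[X] := UniqueFactorizationMonoid.toNormalizedGCDMonoid F[X]
  rw [bchGenerator]
  exact Finset.dvd_lcm (Finset.mem_Icc.2 ⟨hb, hi⟩)

theorem bchGenerator_dvd {p : F[X]}
    (h : ∀ i, b ≤ i → i ≤ b + δ - 2 → minpoly F (β ^ i) ∣ p) : bchGenerator F δ b β ∣ p := by
  classical
  let : NormalizedGCDMonoid F[X] := UniqueFactorizationMonoid.toNormalizedGCDMonoid F[X]
  rw [bchGenerator]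
  exact Finset.lcm_dvd fun i hi => h i (Finset.mem_Icc.1 hi).1 (Finset.mem_Icc.1 hi).2

theorem bchGenerator_dvd_X_pow_sub_one (hβ : β ^ n = 1) : bchGenerator F δ b β ∣ X ^ n - 1 :=
  bchGenerator_dvd fun i _ _ => minpoly.dvd _ _ (by simp [pow_right_comm β i n, hβ])

theorem bchGenerator_monic (hn : n ≠ 0) (hβ : β ^ n = 1) : (bchGenerator F δ b β).Monic := by
  have h0 : bchGenerator F δ b β ≠ 0 :=
    ne_zero_of_dvd_ne_zero (X_pow_sub_one_monic hn).ne_zero (bchGenerator_dvd_X_pow_sub_one hβ)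
  classical
  let : NormalizedGCDMonoid F[X] := UniqueFactorizationMonoid.toNormalizedGCDMonoid F[X]
  have h1 : normalize (bchGenerator F δ b β) = bchGenerator F δ b β := by
    rw [bchGenerator]
    exact Finset.normalize_lcm
  rw [← h1]
  exact monic_normalize h0

theorem aeval_wordPoly {N : ℕ} (c : Fin N → F) (x : K) :
    aeval x (wordPoly F N c) = ∑ i, algebraMap F K (c i) * x ^ (i : ℕ) := by
  simp [wordPoly_apply, aeval_monomial]

open Classical in
/-- The BCH bound for narrow-sense codes. -/
theorem le_hammingNorm_of_aeval_eq_zero (hβ : IsPrimitiveRoot β n) {c : Fin n → F} (hc0 : c ≠ 0)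
    (hc : ∀ i, 1 ≤ i → i < δ → aeval (β ^ i) (wordPoly F n c) = 0) : δ ≤ hammingNorm c := by
  by_contra! hlt
  obtain ⟨j, hj⟩ := Function.ne_iff.1 hc0
  have hβ0 : β ≠ 0 := hβ.ne_zero (Nat.pos_of_ne_zero (by rintro rfl; exact j.elim0)).ne'
  -- Linear combinations of the vanishing conditions; the extra factor `β ^ i` appears because the
  -- zeros start at exponent one.
  have hker : ∀ p : K[X], p.natDegree + 1 < δ →
      ∑ i : Fin n, algebraMap F K (c i) * (β ^ (i : ℕ) * p.eval (β ^ (i : ℕ))) = 0 := by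
    intro p hp
    simp only [eval_eq_sum_range, Finset.mul_sum]
    rw [Finset.sum_comm]
    refine Finset.sum_eq_zero fun k hk => ?_
    have h := hc (k + 1) (by omega) (by have := Finset.mem_range.1 hk; omega)
    rw [aeval_wordPoly] at h
    rw [← mul_zero (p.coeff k), ← h, Finset.mul_sum]
    refine Finset.sum_congr rfl fun i _ => ?_
    rw [← pow_mul, ← pow_mul, add_mul, one_mul, pow_add, mul_comm k]
    ring
  set S : Finset (Fin n) := ({i | c i ≠ 0} : Finset (Fin n)) with hS
  have hjS : j ∈ S := by simpa [hS] using hj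
  have hdeg : (∏ i ∈ S.erase j, (X - C (β ^ (i : ℕ)))).natDegree + 1 = hammingNorm c := by
    rw [natDegree_finsetProd_X_sub_C_eq_card, Finset.card_erase_add_one hjS]
    rfl
  -- This polynomial vanishes on the support of `c` except at `j`, so only the nonzero term at `j`
  -- survives in the sum.
  have h := hker (∏ i ∈ S.erase j, (X - C (β ^ (i : ℕ)))) (by omega)
  rw [Finset.sum_eq_single j] at h
  · have hj' : algebraMap F K (c j) ≠ 0 := by simpa using hj
    refine mul_ne_zero hj' (mul_ne_zero (pow_ne_zero _ hβ0) ?_) h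
    rw [eval_prod, Finset.prod_ne_zero_iff]
    intro i hi
    rw [eval_sub, eval_X, eval_C, sub_ne_zero]
    exact fun he => Finset.ne_of_mem_erase hi (Fin.ext (hβ.pow_inj i.2 j.2 he.symm))
  · intro i _ hij
    by_cases hi : c i = 0
    · simp [hi]
    · have : (∏ k ∈ S.erase j, (X - C (β ^ (k : ℕ)))).eval (β ^ (i : ℕ)) = 0 := by
        rw [eval_prod]
        exact Finset.prod_eq_zero (Finset.mem_erase.2 ⟨hij, by simpa [hS] using hi⟩) (by simp)
      rw [this, mul_zero, mul_zero]
  · simp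

theorem aeval_wordPoly_eq_zero_of_mem_bchCode (hβ : β ^ n = 1) {c : Fin n → F}
    (hc : c ∈ bchCode F n δ 1 β) {i : ℕ} (hi : 1 ≤ i) (hiδ : i < δ) :
    aeval (β ^ i) (wordPoly F n c) = 0 := by
  have h := (mem_cyclicCode_iff (bchGenerator_dvd_X_pow_sub_one hβ)).1 hc
  exact aeval_eq_zero_of_dvd_aeval_eq_zero
    ((minpoly_dvd_bchGenerator hi (by omega)).trans h) (minpoly.aeval F _)

theorem exists_aeval_minpoly_eq_zero_of_aeval_bchGenerator_eq_zero {x : K}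
    (hx : aeval x (bchGenerator F δ b β) = 0) :
    ∃ i, b ≤ i ∧ i ≤ b + δ - 2 ∧ aeval x (minpoly F (β ^ i)) = 0 := by
  have hdvd : bchGenerator F δ b β ∣ ∏ i ∈ Finset.Icc b (b + δ - 2), minpoly F (β ^ i) :=
    bchGenerator_dvd fun i h1 h2 => Finset.dvd_prod_of_mem _ (Finset.mem_Icc.2 ⟨h1, h2⟩)
  have h := aeval_eq_zero_of_dvd_aeval_eq_zero hdvd hx
  rw [map_prod, Finset.prod_eq_zero_iff] at h
  obtain ⟨i, hi, h⟩ := h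
  exact ⟨i, (Finset.mem_Icc.1 hi).1, (Finset.mem_Icc.1 hi).2, h⟩

/-- Roots of a minimal polynomial are Galois conjugate, and Frobenius generates the Galois group. -/
theorem exists_pow_eq_of_aeval_minpoly_eq_zero [Finite F] [FiniteDimensional F K] {x y : K}
    (h : aeval x (minpoly F y) = 0) : ∃ k < Module.finrank F K, x = y ^ Nat.card F ^ k := by
  have := Fintype.ofFinite F
  have : Finite K := Module.finite_of_finite F
  obtain ⟨σ, rfl⟩ := minpoly.exists_algEquiv_of_root' (Algebra.IsAlgebraic.isAlgebraic y) h
  obtain ⟨k, rfl⟩ := (FiniteField.bijective_frobeniusAlgEquivOfAlgebraic_pow F K).surjective σ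
  refine ⟨k, k.2, ?_⟩
  rw [Nat.card_eq_fintype_card, AlgEquiv.coe_pow, FiniteField.coe_frobeniusAlgEquivOfAlgebraic,
    pow_iterate]

/-- The arithmetic behind the dual-containing property of narrow-sense BCH codes. -/
theorem mul_pow_add_ne {q m k a b : ℕ} (hq : 2 ≤ q) (hm : Odd m) (hk : k < m) (ha : 0 < a)
    (hb : 0 < b) (ha' : a + q ≤ q ^ ((m + 1) / 2)) (hb' : b + q ≤ q ^ ((m + 1) / 2)) :
    ¬ (q ^ m - 1) ∣ a * q ^ k + b := by
  -- With `m = 2t + 1` and `l ≤ t`, the sum is at most `(q ^ (t + 1) - q) * q ^ t + q ^ (t + 1) - q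
  -- = q ^ m - q`, which is below `q ^ m - 1`.
  have small : ∀ l ≤ (m - 1) / 2, ∀ a b, 0 < b → a + q ≤ q ^ ((m + 1) / 2) →
      b + q ≤ q ^ ((m + 1) / 2) → ¬ (q ^ m - 1) ∣ a * q ^ l + b := by
    intro l hl a b hb ha' hb' hdvd
    have hle := Nat.le_of_dvd (by positivity) hdvd
    obtain ⟨t, rfl⟩ := hm
    rw [show (2 * t + 1 + 1) / 2 = t + 1 by omega] at ha' hb'
    have hlt : q ^ l ≤ q ^ t := Nat.pow_le_pow_right (by omega) (by omega)
    have h1 : a * q ^ l ≤ a * q ^ t := Nat.mul_le_mul_left _ hlt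
    have h2 : (a + q) * q ^ t ≤ q ^ (t + 1) * q ^ t := Nat.mul_le_mul_right _ ha'
    have h3 : q ^ (2 * t + 1) = q ^ (t + 1) * q ^ t := by ring
    have h4 : q ^ (t + 1) = q * q ^ t := by ring
    rw [add_mul] at h2
    omega
  rcases le_or_gt k ((m - 1) / 2) with h | h
  · exact small k h a b hb ha' hb'
  · intro hdvd
    have hmk : m - k ≤ (m - 1) / 2 := by
      obtain ⟨t, rfl⟩ := hm
      omega
    -- Multiplying by `q ^ (m - k)` and using `q ^ m ≡ 1` exchanges `a` and `b` and replaces `k` by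
    -- `m - k`.
    refine small (m - k) hmk b a ha hb' ha' ?_
    have hpow : q ^ k * q ^ (m - k) = q ^ m := by rw [← pow_add, Nat.add_sub_cancel' hk.le]
    have h1 : (a * q ^ k + b) * q ^ (m - k) = a * (q ^ m - 1) + (b * q ^ (m - k) + a) := by
      have hpos : 1 ≤ q ^ m := Nat.one_le_pow _ _ (by omega)
      obtain ⟨z, hz⟩ := Nat.exists_eq_add_of_le hpos
      rw [hz, Nat.add_sub_cancel_left, add_mul, mul_assoc, hpow, hz]
      ring
    have h2 := hdvd.mul_right (q ^ (m - k))
    rw [h1] at h2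
    exact (Nat.dvd_add_right (dvd_mul_left _ _)).1 h2

theorem aeval_reciprocalPoly_eq_zero {f : F[X]} {x y : K} (hxy : x * y = 1)
    (h : aeval y f = 0) : aeval x (reciprocalPoly f) = 0 := by
  let : Invertible y := ⟨x, hxy, (mul_comm _ _).trans hxy⟩
  have := (eval₂_reverse_eq_zero_iff (algebraMap F K) y f).2 h
  rw [reciprocalPoly, map_mul]
  exact mul_eq_zero_of_right _ this

/-- If no product of conjugates of two roots in the defining set is `1`, then the generator of the
BCH code divides the generator of its dual. -/
theorem bchGenerator_dvd_reciprocalPoly [Finite F] [FiniteDimensional F K] {h : F[X]}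
    (hβ : IsPrimitiveRoot β n) (hn : n ≠ 0) (hgh : bchGenerator F δ b β * h = X ^ n - 1)
    (hZ : ∀ i j k, b ≤ i → i ≤ b + δ - 2 → b ≤ j → j ≤ b + δ - 2 → k < Module.finrank F K →
      ¬ n ∣ i * Nat.card F ^ k + j) :
    bchGenerator F δ b β ∣ reciprocalPoly h := by
  refine bchGenerator_dvd fun j hj hj' => minpoly.dvd _ _ ?_
  have hj0 : β ^ j ≠ 0 := pow_ne_zero _ (hβ.ne_zero hn)
  refine aeval_reciprocalPoly_eq_zero (mul_inv_cancel₀ hj0) ?_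
  -- The inverse of `β ^ j` is a root of `g` or of `h`. A root of `h` is what is wanted; a root of
  -- `g` contradicts `hZ`.
  have hroot : aeval (β ^ j)⁻¹ (bchGenerator F δ b β * h) = 0 := by
    rw [hgh]
    simp [← pow_mul, mul_comm j n, pow_mul β n j, hβ.pow_eq_one]
  rw [map_mul] at hroot
  refine (mul_eq_zero.1 hroot).resolve_left fun hg => ?_
  obtain ⟨i, hi, hi', hx⟩ :=
    exists_aeval_minpoly_eq_zero_of_aeval_bchGenerator_eq_zero hg
  obtain ⟨k, hk, hx⟩ := exists_pow_eq_of_aeval_minpoly_eq_zero hx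
  refine hZ i j k hi hi' hj hj' hk (hβ.dvd_of_pow_eq_one _ ?_)
  rw [pow_add, pow_mul, ← hx, inv_mul_cancel₀ hj0]

end BCH

/-! ### The main theorem -/

theorem theorem5p1 {F K : Type*} [Field F] [Field K] [Algebra F K]
    (s q m μ n δ : ℕ) (hs : 1 ≤ s) (hq : q = 2 ^ s) (hF : Nat.card F = q)
    (hm : Odd m) (hK : Module.finrank F K = m)
    (hμ : μ ∈ (q ^ m - 1).properDivisors) (hn : n = (q ^ m - 1) / μ) (hn4 : 4 < n)
    (hδ : δ = (q ^ ((m + 1) / 2) - q + 1) / μ) (hδ2 : 2 ≤ δ)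
    (β : K) (hβ : IsPrimitiveRoot β n) :
    IsGeneratorPolynomial (bchCode F n δ 1 β) (bchGenerator F δ 1 β) ∧
    IsGeneratorPolynomial (euclideanDual (bchCode F n δ 1 β)) (bchDualGenerator F n δ 1 β) ∧
    IsGeneratorPolynomial (doubledBCHCode F n δ 1 β)
      (bchGenerator F δ 1 β * bchDualGenerator F n δ 1 β) ∧
    IsCyclicCode (doubledBCHCode F n δ 1 β) ∧
    IsSelfDualCode (doubledBCHCode F n δ 1 β) ∧
    Module.finrank F (doubledBCHCode F n δ 1 β) = n ∧
    minDist (doubledBCHCode F n δ 1 β) =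
      min (2 * minDist (bchCode F n δ 1 β)) (minDist (euclideanDual (bchCode F n δ 1 β))) ∧
    δ ≤ minDist (doubledBCHCode F n δ 1 β) ∧
    (μ = 1 → q = 2 →
      2 * n = 2 * (2 ^ m - 1) ∧
      Module.finrank F (doubledBCHCode F n δ 1 β) = 2 ^ m - 1 ∧
      2 ^ ((m + 1) / 2) ≤ minDist (doubledBCHCode F n δ 1 β)) := by
  have hF0 : 2 ≤ q := hq ▸ Nat.le_self_pow (by omega) 2
  have : Finite F := Nat.finite_of_card_ne_zero (by omega)
  have : FiniteDimensional F K := Module.finite_of_finrank_pos (hK ▸ hm.pos)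
  have : CharP F 2 := by
    have := Fintype.ofFinite F
    obtain ⟨p, hp⟩ := CharP.exists F
    obtain ⟨k, hpp, hk⟩ := FiniteField.card F p
    rw [← Nat.card_eq_fintype_card, hF, hq] at hk
    have h2 : p ∣ 2 ^ s := hk ▸ dvd_pow_self p k.ne_zero
    rwa [(Nat.prime_dvd_prime_iff_eq hpp Nat.prime_two).1 (hpp.dvd_of_dvd_pow h2)] at hp
  obtain ⟨hμd, hμlt⟩ := Nat.mem_properDivisors.1 hμ
  have hμ0 : 0 < μ := Nat.pos_of_dvd_of_pos hμd (by omega)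
  have hnμ : n * μ = q ^ m - 1 := by rw [hn, Nat.div_mul_cancel hμd]
  have hnodd : Odd n := by
    have h1 : Odd (q ^ m - 1) :=
      Nat.Even.sub_odd (Nat.one_le_pow _ _ (by omega))
        ((hq ▸ (Nat.even_pow.2 ⟨even_two, by omega⟩) : Even q).pow_of_ne_zero hm.pos.ne') odd_one
    exact Nat.Odd.of_mul_left (hnμ ▸ h1)
  have hn0 : n ≠ 0 := by omega
  have hδμ : δ * μ + q ≤ q ^ ((m + 1) / 2) + 1 := by
    have h1 : δ * μ ≤ q ^ ((m + 1) / 2) - q + 1 := hδ ▸ Nat.div_mul_le_self _ _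
    have h2 : q ≤ q ^ ((m + 1) / 2) := Nat.le_self_pow (by have := hm.pos; omega) q
    omega
  have hgm : (bchGenerator F δ 1 β).Monic := bchGenerator_monic hn0 hβ.pow_eq_one
  have hgd : bchGenerator F δ 1 β ∣ X ^ n - 1 := bchGenerator_dvd_X_pow_sub_one hβ.pow_eq_one
  have hdual : bchDualGenerator F n δ 1 β =
      reciprocalPoly ((X ^ n - 1) / bchGenerator F δ 1 β) := by
    rw [bchDualGenerator, sub_eq_add_neg, CharTwo.neg_eq]
  have hgh : bchGenerator F δ 1 β * ((X ^ n - 1) / bchGenerator F δ 1 β) = X ^ n - 1 :=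
    EuclideanDomain.mul_div_cancel' hgm.ne_zero hgd
  have hdouble : doubledBCHCode F n δ 1 β =
    cyclicCode (2 * n) (bchGenerator F δ 1 β * bchDualGenerator F n δ 1 β) := rfl
  rw [hdual] at hdouble ⊢
  set g := bchGenerator F δ 1 β with hg
  set h := (X ^ n - 1) / g with hh
  have hrec := reciprocalPoly_mul_eq hn0 hgh
  have hh0 : h.coeff 0 ≠ 0 := coeff_zero_ne_of_dvd hn0 ⟨g, by rw [← hgh, mul_comm]⟩
  have hrd : reciprocalPoly h ∣ X ^ n - 1 := ⟨_, by rw [← hrec, mul_comm]⟩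
  have hcode : bchCode F n δ 1 β = cyclicCode n g := rfl
  have hcodeDual : euclideanDual (bchCode F n δ 1 β) = cyclicCode n (reciprocalPoly h) :=
    euclideanDual_cyclicCode hn0 hgh
  have hgr : g ∣ reciprocalPoly h := by
    refine bchGenerator_dvd_reciprocalPoly hβ hn0 hgh fun i j k hi hi' hj hj' hk hdvd => ?_
    -- Exponents stop at `δ - 1`, so the spare `μ ≥ 1` absorbs the `+ 1` in `hδμ`.
    have hbound : ∀ i, i ≤ 1 + δ - 2 → i * μ + q ≤ q ^ ((m + 1) / 2) := fun i hi => by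
      have h1 : (i + 1) * μ ≤ δ * μ := Nat.mul_le_mul_right _ (by omega)
      rw [add_mul] at h1
      omega
    refine mul_pow_add_ne hF0 hm (hK ▸ hk) (Nat.mul_pos hi hμ0) (Nat.mul_pos hj hμ0)
      (hbound i hi') (hbound j hj') ?_
    rw [← hnμ, ← hF, show i * μ * Nat.card F ^ k + j * μ = (i * Nat.card F ^ k + j) * μ by ring]
    exact Nat.mul_dvd_mul_right hdvd μ
  have hle : cyclicCode n (reciprocalPoly h) ≤ cyclicCode n g := fun c hc =>
    (mem_cyclicCode_iff hgd).2 (hgr.trans ((mem_cyclicCode_iff hrd).1 hc))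
  -- The dual has dimension `deg g`, so it is nontrivial and its minimum distance is not the default
  -- value.
  have hg0 : g.natDegree ≠ 0 := by
    have hint : IsIntegral F (β ^ 1) := Algebra.IsIntegral.isIntegral _
    have h1 : (minpoly F (β ^ 1)).natDegree ≤ g.natDegree := natDegree_le_of_dvd
      (minpoly_dvd_bchGenerator (F := F) (β := β) (δ := δ) le_rfl (by omega)) hgm.ne_zero
    have h2 := minpoly.natDegree_pos hint
    omega
  have hr0 : cyclicCode n (reciprocalPoly h) ≠ ⊥ := fun hbot => by
    have := finrank_cyclicCode hn0 ((mul_comm _ _).trans hrec)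
    rw [hbot, finrank_bot, natDegree_reciprocalPoly
      (coeff_zero_ne_of_dvd hn0 ⟨h, hgh.symm⟩)] at this
    exact hg0 this.symm
  have hC0 : cyclicCode n g ≠ ⊥ := fun hbot => hr0 (le_bot_iff.1 (hbot ▸ hle))
  have hself := isSelfDualCode_cyclicCode_two_mul hn0 hgm hgh
  have hfin := finrank_cyclicCode_two_mul hn0 hgh
  have : PerfectRing F 2 := inferInstance
  have hmin := minDist_cyclicCode_two_mul hnodd hgr hrd hr0
  have hbch : δ ≤ minDist (cyclicCode n g) := le_minDist hC0 fun c hc hc0 =>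
    le_hammingNorm_of_aeval_eq_zero hβ hc0 fun i hi hiδ =>
      aeval_wordPoly_eq_zero_of_mem_bchCode hβ.pow_eq_one hc hi hiδ
  have hδmin : δ ≤ minDist (cyclicCode (2 * n) (g * reciprocalPoly h)) := by
    rw [hmin]
    exact le_min (by omega) (hbch.trans (minDist_anti hr0 hle))
  rw [hcodeDual, hcode, hdouble]
  refine ⟨⟨hgm, hgd, rfl⟩, ⟨reciprocalPoly_monic hh0, hrd, rfl⟩,
    ⟨hgm.mul (reciprocalPoly_monic hh0), ?_, rfl⟩, isCyclicCode_cyclicCode _, hself, hfin, hmin,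
    hδmin, ?_⟩
  · rw [X_pow_two_mul_sub_one]
    exact mul_dvd_mul hgd hrd
  · rintro rfl rfl
    rw [mul_one] at hnμ
    refine ⟨by rw [hnμ], hfin.trans hnμ, ?_⟩
    have hne : cyclicCode (2 * n) (g * reciprocalPoly h) ≠ ⊥ := fun hbot => by
      rw [hbot, finrank_bot] at hfin
      exact hn0 hfin.symm
    -- Here `δ = 2 ^ ((m + 1) / 2) - 1` is odd, so an even distance exceeds it by at least one.
    have heven := even_minDist_of_isSelfDualCode hF hself hne
    rw [Nat.div_one] at hδ
    have hpow : Even (2 ^ ((m + 1) / 2)) :=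
      Nat.even_pow.2 ⟨even_two, by have := hm.pos; omega⟩
    rw [Nat.even_iff] at heven hpow
    omega
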